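/- Let $f(\mathbf z,\bar{\mathbf z})=\sum_{\nu,\mu}c_{\nu\mu}\mathbf z^\nu\bar{\mathbf z}^\mu$ be a nonzero mixed polynomial on $\mathbb C^n$. Let $\Gamma_+(f)$ be the convex hull of $\bigcup_{c_{\nu\mu}\neq0}(\nu+\mu+\mathbb R_{\ge 0}^n)$. For a weight $P=(p_1,\dots,p_n)$ with all $p_i\ge 0$, let $\Delta(P)$ be the face of $\Gamma_+(f)$ on which $\xi\mapsto\sum_i p_i\xi_i$ is minimal, and put $I(P)=\{i: p_i=0\}$. Let $\Gamma(f)$ be the union of the compact faces of $\Gamma_+(f)$. For $\Delta\subset\mathbb R^n$ put $f_\Delta=\sum_{\nu+\mu\in\Delta}c_{\nu\mu}\mathbf z^\nu\bar{\mathbf z}^\mu$, and for $I\subset\{1,\dots,n\}$ let $f^I$ be the restriction of $f$ to $\mathbb C^I=\{\mathbf z: z_i=0 \text{ for } i\notin I\}$. The subspace $\mathbb C^I$ is called a vanishing coordinate subspace if $f^I\equiv0$. An essential non-compact face with non-compact direction $I(\Delta)=I$ is a non-compact face $\Delta=\Delta(P)$ with $I(P)=I$ and $f^I\equiv 0$,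 such that $\xi+\mathbb R_{\ge0}E_i\subset\Delta$ for all $\xi\in\Delta$ and $i\in I$, where $E_i$ is the $i$-th unit vector. A critical point of a map to $\mathbb C$ is a point where its real differential is not surjective onto $\mathbb C=\mathbb R^2$. Call $f$ strongly non-degenerate if $f_\Delta:(\mathbb C^*)^n\to\mathbb C$ has no critical point for every compact face $\Delta$ of $\Gamma_+(f)$, and $f_{\Delta\cap\Gamma(f)}:(\mathbb C^*)^n\to\mathbb C$ has no critical point for every essential non-compact face $\Delta$. Call $f$ locally tame along the vanishing coordinate subspaces if for every $I$ with $f^I\equiv0$ and every essential non-compact face $\Delta$ with $I(\Delta)=I$ there is $r_\Delta>0$ such that, for every fixed $(z_j)_{j\in I}\in(\mathbb C^*)^I$ with $\sum_{j\in I}|z_j|^2\le r_\Delta^2$, the function $f_\Delta$ of the remaining variables $(z_k)_{k\notin I}$ has no critical point in $(\mathbb C^*)^{I^c}$. Let $V=f^{-1}(0)$, let $B_r$ be the open ball of radius $r$ about the origin in $\mathbb C^n$ (Euclidean norm), and for $\theta\in\mathbb R$ let $$F_{\theta,\le r}=\{\mathbf z\in B_r\setminus V:\ f(\mathbf z,\bar{\mathbf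 z})/|f(\mathbf z,\bar{\mathbf z})|=e^{i\theta}\}$$ be the fiber over $e^{i\theta}$ of the open ball Milnor map $f/|f|:B_r\setminus V\to S^1$. Suppose that $f$ is strongly non-degenerate and locally tame along the vanishing coordinate subspaces. Then the open ball Milnor fibration of $f$ has the stable boundary property: there is $r_0>0$ such that for every $0<r\le r_0$ and every $\theta\in\mathbb R$, the closure of $F_{\theta,\le r}$ contains $V\cap B_r$. -/

import Mathlib

namespace MixedMilnor

/-- A mixed polynomial `f(z, z̄) = ∑ c_{νμ} z^ν z̄^μ` in `n` complex variables: the variable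
`Sum.inl i` stands for `z_i`, and `Sum.inr i` stands for its conjugate. -/
abbrev MixedPolynomial (n : ℕ) : Type := MvPolynomial (Fin n ⊕ Fin n) ℂ

/-- The value of the mixed polynomial `f` at `z ∈ ℂⁿ`. -/
noncomputable def value {n : ℕ} (f : MixedPolynomial n) (z : Fin n → ℂ) : ℂ :=
  MvPolynomial.eval (Sum.elim z (fun i => (starRingEnd ℂ) (z i))) f

/-- The point `ν + μ ∈ ℝⁿ` attached to the monomial `z^ν z̄^μ`. -/
def totalExponent {n : ℕ} (m : Fin n ⊕ Fin n →₀ ℕ) : Fin n → ℝ :=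
  fun i => (m (Sum.inl i) : ℝ) + (m (Sum.inr i) : ℝ)

/-- The Newton polygon `Γ₊(f)`: the convex hull of the union of the orthants
`ν + μ + ℝ₊ⁿ` over all `(ν, μ)` with `c_{νμ} ≠ 0`. -/
def newtonPolygon {n : ℕ} (f : MixedPolynomial n) : Set (Fin n → ℝ) :=
  convexHull ℝ (⋃ m ∈ f.support, {ξ : Fin n → ℝ | ∀ i, totalExponent m i ≤ ξ i})

/-- The linear function `ℓ_P(ξ) = ∑ p_i ξ_i`. -/
def weightFunction {n : ℕ} (P ξ : Fin n → ℝ) : ℝ := ∑ i, P i * ξ i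

/-- The face `Δ(P)` of `Γ₊(f)` on which `ℓ_P` takes its minimal value. -/
def faceOfWeight {n : ℕ} (f : MixedPolynomial n) (P : Fin n → ℝ) : Set (Fin n → ℝ) :=
  {ξ | ξ ∈ newtonPolygon f ∧ ∀ η ∈ newtonPolygon f, weightFunction P ξ ≤ weightFunction P η}

/-- `Δ` is a compact face of the Newton polygon. -/
def IsCompactFace {n : ℕ} (f : MixedPolynomial n) (Δ : Set (Fin n → ℝ)) : Prop :=
  (∃ P : Fin n → ℝ, (∀ i, 0 ≤ P i) ∧ Δ = faceOfWeight f P) ∧ IsCompact Δ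

/-- The Newton boundary `Γ(f)`: the union of the compact faces of `Γ₊(f)`. -/
def newtonBoundary {n : ℕ} (f : MixedPolynomial n) : Set (Fin n → ℝ) :=
  {ξ | ∃ Δ : Set (Fin n → ℝ), IsCompactFace f Δ ∧ ξ ∈ Δ}

/-- `f^I ≡ 0`: the restriction of `f` to the coordinate subspace
`ℂ^I = {z | z_i = 0 for i ∉ I}` vanishes identically. -/
def VanishesOn {n : ℕ} (f : MixedPolynomial n) (I : Finset (Fin n)) : Prop :=
  ∀ z : Fin n → ℂ, (∀ i, i ∉ I → z i = 0) → value f z = 0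

/-- `Δ` is an essential non-compact face with non-compact direction `I(Δ) = I`. -/
def IsEssentialNoncompactFace {n : ℕ} (f : MixedPolynomial n) (I : Finset (Fin n))
    (Δ : Set (Fin n → ℝ)) : Prop :=
  ∃ P : Fin n → ℝ, (∀ i, 0 ≤ P i) ∧ (∀ i, i ∈ I ↔ P i = 0) ∧
    Δ = faceOfWeight f P ∧ ¬ IsCompact Δ ∧ VanishesOn f I ∧
    ∀ i ∈ I, ∀ ξ ∈ Δ, ∀ t : ℝ, 0 ≤ t → ξ + t • Pi.single i (1 : ℝ) ∈ Δ

open Classical in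
/-- `f_Δ`: the sum of the terms `c_{νμ} z^ν z̄^μ` of `f` with `ν + μ ∈ Δ`. -/
noncomputable def faceFunction {n : ℕ} (f : MixedPolynomial n) (Δ : Set (Fin n → ℝ)) :
    MixedPolynomial n :=
  ∑ m ∈ f.support with totalExponent m ∈ Δ, MvPolynomial.monomial m (f.coeff m)

/-- Critical point of a map to `ℂ = ℝ²` in the real sense: the real differential is not onto. -/
def IsCriticalPoint {E : Type*} [NormedAddCommGroup E] [NormedSpace ℝ E]
    (F : E → ℂ) (z : E) : Prop :=
  ¬ Function.Surjective (fderiv ℝ F z)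

/-- `f : (ℂ*)ⁿ → ℂ` has no critical point. -/
def NoCriticalPointOnTorus {n : ℕ} (f : MixedPolynomial n) : Prop :=
  ∀ z : Fin n → ℂ, (∀ i, z i ≠ 0) → ¬ IsCriticalPoint (value f) z

/-- Strong non-degeneracy. -/
def StronglyNondegenerate {n : ℕ} (f : MixedPolynomial n) : Prop :=
  (∀ Δ, IsCompactFace f Δ → NoCriticalPointOnTorus (faceFunction f Δ)) ∧
  (∀ I Δ, IsEssentialNoncompactFace f I Δ →
    NoCriticalPointOnTorus (faceFunction f (Δ ∩ newtonBoundary f)))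

/-- The point of `ℂⁿ` with coordinates `u` in the directions of `I` and `w` in the others. -/
def glue {n : ℕ} {I : Finset (Fin n)} (u : {i // i ∈ I} → ℂ) (w : {i // i ∉ I} → ℂ) :
    Fin n → ℂ :=
  fun i => if h : i ∈ I then u ⟨i, h⟩ else w ⟨i, h⟩

/-- Local tameness of `f_Δ`, where `I = I(Δ)`: there is `r > 0` such that for every fixed
`u = z_I ∈ (ℂ*)^I` with `ρ_Δ = ∑_{j ∈ I} |z_j|² ≤ r²` the function `f_Δ` of the remaining
variables `w = (z_k)_{k ∉ I}` has no critical point in `(ℂ*)^{I^c}`. -/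
def LocallyTameFace {n : ℕ} (f : MixedPolynomial n) (I : Finset (Fin n))
    (Δ : Set (Fin n → ℝ)) : Prop :=
  ∃ r : ℝ, 0 < r ∧ ∀ u : {i // i ∈ I} → ℂ, (∀ j, u j ≠ 0) → ∑ j, ‖u j‖ ^ 2 ≤ r ^ 2 →
    ∀ w : {i // i ∉ I} → ℂ, (∀ k, w k ≠ 0) →
      ¬ IsCriticalPoint (fun w' : {i // i ∉ I} → ℂ => value (faceFunction f Δ) (glue u w')) w

/-- `f` is locally tame on the vanishing coordinate subspace `ℂ^I`. -/
def LocallyTameOn {n : ℕ} (f : MixedPolynomial n) (I : Finset (Fin n)) : Prop :=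
  ∀ Δ, IsEssentialNoncompactFace f I Δ → LocallyTameFace f I Δ

/-- `f` is locally tame along the vanishing coordinate subspaces. -/
def LocallyTame {n : ℕ} (f : MixedPolynomial n) : Prop :=
  ∀ I : Finset (Fin n), VanishesOn f I → LocallyTameOn f I

/-- The mixed hypersurface `V = f⁻¹(0)`. -/
def zeroSet {n : ℕ} (f : MixedPolynomial n) : Set (EuclideanSpace ℂ (Fin n)) :=
  {z | value f (fun i => z i) = 0}

/-- The fiber `F_{θ,≤r}` over `e^{iθ}` of the open ball Milnor map
`f/|f| : B_r ∖ V → S¹`. -/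
def milnorFiber {n : ℕ} (f : MixedPolynomial n) (r θ : ℝ) : Set (EuclideanSpace ℂ (Fin n)) :=
  {z | z ∈ Metric.ball (0 : EuclideanSpace ℂ (Fin n)) r \ zeroSet f ∧
    value f (fun i => z i) / (‖value f (fun i => z i)‖ : ℂ) = Complex.exp (θ * Complex.I)}

/-- The stable boundary property in the ball `B_r`: the closure of every fiber contains `V`. -/
def StableBoundary {n : ℕ} (f : MixedPolynomial n) (r : ℝ) : Prop :=
  ∀ θ : ℝ, zeroSet f ∩ Metric.ball (0 : EuclideanSpace ℂ (Fin n)) r ⊆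
    closure (milnorFiber f r θ)

end MixedMilnor

/-!
Let `a` be a zero of `f` close to the origin.

If some monomial of `f` does not vanish at `a`, then `f` is a submersion at `a`. Otherwise there
would be such critical points `a` converging to `0`, which may be compared with points of the torus
at which every monomial of `f` has almost the same value. The vectors `-log |a_i|` then diverge, and
a recession direction `P` of the finitely many linear forms `ν + μ` along them is a positive weight:
after rescaling, the monomials of `f` at `a` converge to those of `f_Δ(P)` at a point `b` of the
torus. In logarithmic coordinates the differential of a mixed polynomial is linear in its monomials,
so the rescaled differentials converge to that of `f_Δ(P)` at `b`, which is surjective because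
`Δ(P)` is compact.

If all monomials of `f` vanish at `a`, then `a` lies in the torus of a vanishing coordinate subspace
`ℂ^I`. For a generic weight `p` that vanishes exactly on `I`, all terms of `f_Δ(p)` have the same
total exponents outside `I`. By tameness its restriction to the slice through `a` is a submersion on
the torus `(ℂ*)^{I^c}`, whose image is therefore an open cone over a compact set, hence contains
`ℂ* = ℂ \ {0}`. Since `t^{-d} f(t^p z)` tends to `f_Δ(p)(z)` as `t → 0⁺`, the implicit function
theorem yields points near `a` where `f` takes a prescribed nonzero value up to a positive factor.
-/

namespace MixedMilnor

open Filter Topology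
open scoped Pointwise

/-! ### Recession directions, cones and submersions -/

theorem exists_comp_comp_eq_self {K V W : Type*} [DivisionRing K] [AddCommGroup V] [Module K V]
    [AddCommGroup W] [Module K W] (A : V →ₗ[K] W) : ∃ B : W →ₗ[K] V, A ∘ₗ B ∘ₗ A = A := by
  obtain ⟨g, hg⟩ := A.rangeRestrict.exists_rightInverse_of_surjective A.range_rangeRestrict
  obtain ⟨B, hB⟩ := g.exists_extend
  refine ⟨B, LinearMap.ext fun x => ?_⟩
  have hBA : B (A x) = g (A.rangeRestrict x) := LinearMap.congr_fun hB (A.rangeRestrict x)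
  have hgA : A.rangeRestrict (g (A.rangeRestrict x)) = A.rangeRestrict x :=
    LinearMap.congr_fun hg _
  rw [LinearMap.comp_apply, LinearMap.comp_apply, hBA]
  exact congrArg Subtype.val hgA

theorem exists_recession_direction {α V J : Type*} [AddCommGroup V] [Module ℝ V] [Finite J]
    {l : Filter α} [l.NeBot] (ℓ : J → V →ₗ[ℝ] ℝ) {x : α → V} {S : Set J}
    (hconv : ∀ j ∈ S, ∃ c, Tendsto (fun t => ℓ j (x t)) l (𝓝 c))
    (hdiv : ∀ j ∉ S, Tendsto (fun t => ℓ j (x t)) l atTop) :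
    ∃ β P : V, (∀ j ∈ S, ℓ j P = 0 ∧ Tendsto (fun t => ℓ j (x t)) l (𝓝 (ℓ j β))) ∧
      ∀ j ∉ S, 0 < ℓ j P := by
  choose c hc using fun j : S => hconv j j.2
  let A : V →ₗ[ℝ] S → ℝ := LinearMap.pi fun j : S => ℓ j
  have hA : Tendsto (fun t => A (x t)) l (𝓝 c) := tendsto_pi_nhds.2 hc
  obtain ⟨B, hB⟩ := exists_comp_comp_eq_self A
  have hBA (v : V) (j : J) (hj : j ∈ S) : ℓ j (B (A v)) = ℓ j v :=
    congrFun (LinearMap.congr_fun hB v) ⟨j, hj⟩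
  have hlim (j : J) : Tendsto (fun t => ℓ j (B (A (x t)))) l (𝓝 (ℓ j (B c))) :=
    ((ℓ j ∘ₗ B).continuous_of_finiteDimensional.tendsto c).comp hA
  have hpos : ∀ᶠ t in l, ∀ j, j ∉ S → 0 < ℓ j (x t - B (A (x t))) := by
    refine eventually_all.2 fun j => ?_
    by_cases hj : j ∈ S
    · simp [hj]
    · filter_upwards [((hdiv j hj).atTop_add (hlim j).neg).eventually_gt_atTop 0] with t ht _
      simpa [sub_eq_add_neg] using ht
  obtain ⟨t, ht⟩ := hpos.exists
  refine ⟨B c, x t - B (A (x t)), fun j hj => ⟨?_, ?_⟩, ht⟩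
  · rw [map_sub, hBA _ j hj, sub_self]
  · exact (hlim j).congr fun t => hBA _ j hj

theorem exists_tendsto_nhds_or_tendsto_atTop {α : Type*} (𝒰 : Ultrafilter α) {y : α → ℝ} {c : ℝ}
    (hc : ∀ᶠ t in (𝒰 : Filter α), c ≤ y t) :
    (∃ d, Tendsto y 𝒰 (𝓝 d)) ∨ Tendsto y 𝒰 atTop := by
  by_cases h : ∃ C, ∀ᶠ t in (𝒰 : Filter α), y t ≤ C
  · obtain ⟨C, hC⟩ := h
    obtain ⟨d, -, hd⟩ := (isCompact_Icc (a := c) (b := C)).ultrafilter_le_nhds' (𝒰.map y)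
      (hc.and hC)
    exact .inl ⟨d, hd⟩
  · push Not at h
    refine .inr (tendsto_atTop.2 fun C => ?_)
    exact (h C).mono fun _ ht => ht.le

theorem exists_eventually_forall_le {α ι R : Type*} [LinearOrder R] (𝒰 : Ultrafilter α)
    {s : Finset ι} (hs : s.Nonempty) (y : α → ι → R) :
    ∃ i₀ ∈ s, ∀ᶠ t in (𝒰 : Filter α), ∀ i ∈ s, y t i₀ ≤ y t i :=
  (Ultrafilter.eventually_exists_mem_iff s.finite_toSet).1 <| .of_forall fun t =>
    s.exists_min_image (y t) hs

theorem eventually_surjective_of_tendsto {𝕜 E F α : Type*} [NontriviallyNormedField 𝕜]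
    [CompleteSpace 𝕜] [AddCommGroup E] [Module 𝕜 E] [NormedAddCommGroup F] [NormedSpace 𝕜 F]
    [FiniteDimensional 𝕜 F] {l : Filter α} {L : α → E →ₗ[𝕜] F} {L₀ : E →ₗ[𝕜] F}
    (hL : ∀ v, Tendsto (fun t => L t v) l (𝓝 (L₀ v))) (hL₀ : Function.Surjective L₀) :
    ∀ᶠ t in l, Function.Surjective (L t) := by
  let b := Module.finBasis 𝕜 F
  choose v hv using fun i => hL₀ (b i)
  have hlim : Tendsto (fun t i => L t (v i)) l (𝓝 b) :=
    tendsto_pi_nhds.2 fun i => by simpa only [hv] using hL (v i)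
  filter_upwards [hlim.eventually (isOpen_setOfPred_linearIndependent.mem_nhds
    b.linearIndependent)] with t ht
  rw [← LinearMap.range_eq_top, eq_top_iff,
    ← LinearIndependent.span_eq_top_of_card_eq_finrank' ht (Fintype.card_fin _), Submodule.span_le]
  rintro _ ⟨i, rfl⟩
  exact ⟨v i, rfl⟩

theorem closure_pos_smul_subset {E : Type*} [NormedAddCommGroup E] [NormedSpace ℝ E] {K : Set E}
    (hK : IsCompact K) (h0 : (0 : E) ∉ K) :
    closure (Set.Ioi (0 : ℝ) • K) ⊆ insert 0 (Set.Ioi (0 : ℝ) • K) := by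
  let φ : E → E := fun x => ‖x‖⁻¹ • x
  have hφ : ContinuousOn φ {0}ᶜ :=
    (continuousOn_id.norm.inv₀ fun x hx => norm_ne_zero_iff.2 hx).smul continuousOn_id
  have hK0 : K ⊆ {0}ᶜ := fun x hx hx0 => h0 (hx0 ▸ hx)
  have hcone : φ '' (Set.Ioi (0 : ℝ) • K) ⊆ φ '' K := by
    rintro _ ⟨_, ⟨s, hs, κ, hκ, rfl⟩, rfl⟩
    have hs0 : s ≠ 0 := ne_of_gt hs
    refine ⟨κ, hκ, ?_⟩
    simp only [φ, norm_smul, Real.norm_of_nonneg (le_of_lt hs), smul_smul]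
    congr 1
    field_simp
  refine fun x hx => or_iff_not_imp_left.2 fun hx0 => ?_
  obtain ⟨κ, hκ, hκx⟩ := closure_minimal hcone (hK.image_of_continuousOn (hφ.mono hK0)).isClosed
    (mem_closure_image (hφ.continuousAt (isOpen_compl_singleton.mem_nhds hx0)) hx)
  refine ⟨‖x‖ * ‖κ‖⁻¹, mul_pos (norm_pos_iff.2 hx0) (inv_pos.2 (norm_pos_iff.2 (hK0 hκ))),
    κ, hκ, ?_⟩
  change (‖x‖ * ‖κ‖⁻¹) • κ = x
  rw [mul_smul, show ‖κ‖⁻¹ • κ = ‖x‖⁻¹ • x from hκx, smul_inv_smul₀ (norm_ne_zero_iff.2 hx0)]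

theorem compl_zero_subset_pos_smul {E : Type*} [NormedAddCommGroup E] [NormedSpace ℝ E]
    (hE : 1 < Module.rank ℝ E) {K : Set E} (hK : IsCompact K) (hne : K.Nonempty)
    (hopen : IsOpen (Set.Ioi (0 : ℝ) • K)) : {0}ᶜ ⊆ Set.Ioi (0 : ℝ) • K := by
  have hsub : K ⊆ Set.Ioi (0 : ℝ) • K := fun κ hκ =>
    ⟨1, Set.mem_Ioi.2 one_pos, κ, hκ, one_smul _ _⟩
  by_cases h0 : (0 : E) ∈ K
  · intro x _
    have hray : Tendsto (fun ε : ℝ => ε • x) (𝓝[>] 0) (𝓝 0) := by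
      simpa using ((continuous_id.smul continuous_const).tendsto (0 : ℝ)).mono_left
        (nhdsWithin_le_nhds (s := Set.Ioi 0)) (f := fun ε : ℝ => ε • x)
    obtain ⟨ε, ⟨s, hs, κ, hκ, hsκ⟩, hε⟩ :=
      ((hray.eventually (hopen.mem_nhds (hsub h0))).and self_mem_nhdsWithin).exists
    refine ⟨ε⁻¹ * s, mul_pos (inv_pos.2 hε) hs, κ, hκ, ?_⟩
    change (ε⁻¹ * s) • κ = x
    rw [mul_smul, show s • κ = ε • x from hsκ, inv_smul_smul₀ (ne_of_gt hε)]
  · refine (isConnected_compl_singleton_of_one_lt_rank hE 0).isPreconnected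
      |>.subset_of_closure_inter_subset hopen ?_ ?_
    · obtain ⟨κ, hκ⟩ := hne
      exact ⟨κ, ne_of_mem_of_not_mem hκ h0, hsub hκ⟩
    · rintro x ⟨hx, hx0⟩
      exact (closure_pos_smul_subset hK h0 hx).resolve_left hx0

theorem isOpen_image_of_surjective_fderiv {E F : Type*} [NormedAddCommGroup E] [NormedSpace ℝ E]
    [CompleteSpace E] [NormedAddCommGroup F] [NormedSpace ℝ F] [CompleteSpace F] {g : E → F}
    (hg : ContDiff ℝ 1 g) {U : Set E} (hU : IsOpen U)
    (hsurj : ∀ x ∈ U, Function.Surjective (fderiv ℝ g x)) : IsOpen (g '' U) := by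
  refine isOpen_iff_mem_nhds.2 ?_
  rintro _ ⟨x, hx, rfl⟩
  rw [← (hg.hasStrictFDerivAt one_ne_zero).map_nhds_eq_of_surj
    (LinearMap.range_eq_top.2 (hsurj x hx))]
  exact image_mem_map (hU.mem_nhds hx)

theorem eventually_exists_eq_of_surjective {𝕜 X E H : Type*} [NontriviallyNormedField 𝕜]
    [CompleteSpace 𝕜]
    [NormedAddCommGroup X] [NormedSpace 𝕜 X] [CompleteSpace X]
    [NormedAddCommGroup E] [NormedSpace 𝕜 E] [CompleteSpace E]
    [NormedAddCommGroup H] [NormedSpace 𝕜 H] [CompleteSpace H]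
    {F : X × E → H} {F' : X × E →L[𝕜] H} {x₀ : X} {w₀ : E} (hF : HasStrictFDerivAt F F' (x₀, w₀))
    (hsurj : Function.Surjective fun w => F' (0, w)) {N : Set (X × E)} (hN : N ∈ 𝓝 (x₀, w₀)) :
    ∀ᶠ x in 𝓝 x₀, ∃ w, (x, w) ∈ N ∧ F (x, w) = F (x₀, w₀) := by
  have hG : HasStrictFDerivAt (fun q : X × E => (q.1, F q))
      ((ContinuousLinearMap.fst 𝕜 X E).prod F') (x₀, w₀) := hasStrictFDerivAt_fst.prodMk hF
  have hG' : ((ContinuousLinearMap.fst 𝕜 X E).prod F').range = ⊤ := by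
    refine LinearMap.range_eq_top.2 fun ⟨x, y⟩ => ?_
    obtain ⟨w, hw⟩ := hsurj (y - F' (x, 0))
    refine ⟨(x, w), Prod.ext rfl ?_⟩
    have hadd : F' (x, w) = F' (x, 0) + F' (0, w) := by rw [← map_add]; simp
    simp only at hw
    simp [hadd, hw]
  have hmem := image_mem_map (m := fun q : X × E => (q.1, F q)) hN
  rw [hG.map_nhds_eq_of_surj hG'] at hmem
  have hcurve : Tendsto (fun x => (x, F (x₀, w₀))) (𝓝 x₀) (𝓝 (x₀, F (x₀, w₀))) :=
    (continuous_id.prodMk continuous_const).tendsto x₀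
  filter_upwards [hcurve hmem] with x hx
  obtain ⟨⟨x', w⟩, hq, hxw⟩ := hx
  obtain ⟨rfl, hw⟩ := Prod.ext_iff.1 hxw
  exact ⟨w, hq, hw⟩

theorem exists_pos_nat_dotProduct_ne_zero {ι R : Type*} [Fintype ι] [CommRing R] [IsDomain R]
    [CharZero R] (Q : Finset (ι → R)) (hQ : 0 ∉ Q) :
    ∃ p : ι → ℕ, (∀ i, 0 < p i) ∧ ∀ q ∈ Q, (fun i => (p i : R)) ⬝ᵥ q ≠ 0 := by
  classical
  by_contra! h
  let L (q : ι → R) : MvPolynomial ι R := ∑ i, MvPolynomial.C (q i) * MvPolynomial.X i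
  have hL (q x : ι → R) : MvPolynomial.eval x (L q) = x ⬝ᵥ q := by
    simp [L, dotProduct, mul_comm]
  have hprod : ∏ q ∈ Q, L q = 0 := by
    refine MvPolynomial.funext_set (fun _ => Set.range fun k : ℕ => ((k + 1 : ℕ) : R))
      (fun _ => Set.infinite_range_of_injective
        (Nat.cast_injective.comp (add_left_injective 1))) fun x hx => ?_
    choose k hk using fun i => hx i (Set.mem_univ i)
    obtain ⟨q, hq, hq0⟩ := h (fun i => k i + 1) fun i => Nat.succ_pos _
    rw [map_zero, map_prod]
    exact Finset.prod_eq_zero hq (by rw [hL, ← funext hk, hq0])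
  obtain ⟨q, hq, hLq⟩ := Finset.prod_eq_zero_iff.1 hprod
  refine hQ ((?_ : q = 0) ▸ hq)
  ext i
  simpa [hLq] using (hL q (Pi.single i 1)).symm

variable {n : ℕ}

/-! ### Mixed monomials and Newton polygons -/

/-- The mixed monomial `z^ν z̄^μ` with exponent `m = (ν, μ)`. -/
noncomputable def mixedMonomial (m : Fin n ⊕ Fin n →₀ ℕ) (z : Fin n → ℂ) : ℂ :=
  ∏ i, z i ^ m (Sum.inl i) * (starRingEnd ℂ) (z i) ^ m (Sum.inr i)

/-- The real linear form `∑ ν_i w_i + μ_i w̄_i`, the logarithmic differential of `z^ν z̄^μ`. -/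
noncomputable def logForm (m : Fin n ⊕ Fin n →₀ ℕ) (w : Fin n → ℂ) : ℂ :=
  ∑ i, (m (Sum.inl i) * w i + m (Sum.inr i) * (starRingEnd ℂ) (w i))

theorem value_monomial (m : Fin n ⊕ Fin n →₀ ℕ) (c : ℂ) (z : Fin n → ℂ) :
    value (MvPolynomial.monomial m c) z = c * mixedMonomial m z := by
  rw [value, MvPolynomial.eval_monomial, Finsupp.prod_fintype _ _ (by simp), Fintype.prod_sum_type,
    mixedMonomial, Finset.prod_mul_distrib]
  simp only [Sum.elim_inl, Sum.elim_inr]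

theorem value_eq_sum {f : MixedPolynomial n} {s : Finset (Fin n ⊕ Fin n →₀ ℕ)}
    (hs : f.support ⊆ s) (z : Fin n → ℂ) :
    value f z = ∑ m ∈ s, f.coeff m * mixedMonomial m z := by
  rw [← Finset.sum_subset hs fun m _ hm => by
    rw [MvPolynomial.notMem_support_iff.1 hm, zero_mul]]
  simp only [← value_monomial, value]
  rw [← map_sum, ← f.as_sum]

theorem totalExponent_nonneg (m : Fin n ⊕ Fin n →₀ ℕ) : 0 ≤ totalExponent m :=
  fun _ => add_nonneg (Nat.cast_nonneg _) (Nat.cast_nonneg _)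

theorem totalExponent_eq_zero_iff {m : Fin n ⊕ Fin n →₀ ℕ} {i : Fin n} :
    totalExponent m i = 0 ↔ m (Sum.inl i) = 0 ∧ m (Sum.inr i) = 0 := by
  rw [totalExponent, ← Nat.cast_add, Nat.cast_eq_zero, Nat.add_eq_zero_iff]

theorem mixedMonomial_mul (m : Fin n ⊕ Fin n →₀ ℕ) (z w : Fin n → ℂ) :
    mixedMonomial m (z * w) = mixedMonomial m z * mixedMonomial m w := by
  simp only [mixedMonomial, ← Finset.prod_mul_distrib, Pi.mul_apply, map_mul, mul_pow]
  exact Finset.prod_congr rfl fun i _ => by ring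

theorem mixedMonomial_eq_zero_iff {m : Fin n ⊕ Fin n →₀ ℕ} {z : Fin n → ℂ} :
    mixedMonomial m z = 0 ↔ ∃ i, z i = 0 ∧ totalExponent m i ≠ 0 := by
  simp only [mixedMonomial, Finset.prod_eq_zero_iff, Finset.mem_univ, true_and, mul_eq_zero,
    pow_eq_zero_iff', map_eq_zero, Ne, totalExponent_eq_zero_iff]
  exact exists_congr fun i => by tauto

theorem mixedMonomial_zero_ne_zero_iff {m : Fin n ⊕ Fin n →₀ ℕ} :
    mixedMonomial m 0 ≠ 0 ↔ m = 0 := by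
  simp only [Ne, mixedMonomial_eq_zero_iff, totalExponent_eq_zero_iff, Pi.zero_apply, true_and,
    not_exists, not_not, Finsupp.ext_iff, Sum.forall, forall_and, Finsupp.coe_zero]

theorem value_zero (f : MixedPolynomial n) : value f 0 = f.coeff 0 := by
  simp only [value, Pi.zero_apply, map_zero]
  rw [show Sum.elim (0 : Fin n → ℂ) (fun _ : Fin n => (0 : ℂ)) = 0 from Sum.elim_zero_zero,
    MvPolynomial.eval_zero, MvPolynomial.constantCoeff_eq]

theorem mixedMonomial_exp (m : Fin n ⊕ Fin n →₀ ℕ) (w : Fin n → ℂ) :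
    mixedMonomial m (fun i => Complex.exp (w i)) = Complex.exp (logForm m w) := by
  simp only [mixedMonomial, logForm, Complex.exp_sum, Complex.exp_add, Complex.exp_nat_mul,
    Complex.exp_conj]

theorem logForm_ofReal_smul (m : Fin n ⊕ Fin n →₀ ℕ) (s : ℝ) (w : Fin n → ℂ) :
    logForm m ((s : ℂ) • w) = s * logForm m w := by
  simp only [logForm, Finset.mul_sum, Pi.smul_apply, smul_eq_mul, map_mul, Complex.conj_ofReal]
  exact Finset.sum_congr rfl fun i _ => by ring

theorem mixedMonomial_exp_ofReal (m : Fin n ⊕ Fin n →₀ ℕ) (x : Fin n → ℝ) :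
    mixedMonomial m (fun i => (Real.exp (x i) : ℂ)) =
      (Real.exp (weightFunction x (totalExponent m)) : ℂ) := by
  have hlog : logForm m (fun i => (x i : ℂ)) = (weightFunction x (totalExponent m) : ℂ) := by
    simp only [logForm, weightFunction, totalExponent, Complex.conj_ofReal]
    push_cast
    exact Finset.sum_congr rfl fun i _ => by ring
  simp only [Complex.ofReal_exp]
  rw [mixedMonomial_exp m (fun i => (x i : ℂ)), hlog]

theorem value_exp_mul {g : MixedPolynomial n} {x : Fin n → ℝ} {d : ℝ}
    (hg : ∀ m ∈ g.support, weightFunction x (totalExponent m) = d) (z : Fin n → ℂ) :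
    value g ((fun i => (Real.exp (x i) : ℂ)) * z) = Real.exp d * value g z := by
  rw [value_eq_sum subset_rfl, value_eq_sum subset_rfl, Finset.mul_sum]
  refine Finset.sum_congr rfl fun m hm => ?_
  rw [mixedMonomial_mul, mixedMonomial_exp_ofReal, hg m hm]
  ring

theorem contDiff_mixedMonomial (m : Fin n ⊕ Fin n →₀ ℕ) {k : WithTop ℕ∞} :
    ContDiff ℝ k (mixedMonomial m) :=
  contDiff_prod fun i _ => ((contDiff_apply ℝ ℂ i).pow _).mul
    ((Complex.conjCLE.contDiff.comp (contDiff_apply ℝ ℂ i)).pow _)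

theorem contDiff_value (f : MixedPolynomial n) {k : WithTop ℕ∞} : ContDiff ℝ k (value f) := by
  rw [funext (value_eq_sum (subset_refl f.support))]
  exact ContDiff.sum fun m _ => contDiff_const.mul (contDiff_mixedMonomial m)

theorem fderiv_mixedMonomial_mul (m : Fin n ⊕ Fin n →₀ ℕ) (a w : Fin n → ℂ) :
    fderiv ℝ (mixedMonomial m) a (a * w) = mixedMonomial m a * logForm m w := by
  have hexp (v : ℂ) : HasDerivAt (fun t : ℝ => Complex.exp (t * v)) v 0 := by
    simpa using ((Complex.ofRealCLM.hasDerivAt (x := (0 : ℝ))).mul_const v).cexp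
  have hcurve : HasDerivAt (fun t : ℝ => a * fun i => Complex.exp (t * w i)) (a * w) 0 :=
    hasDerivAt_pi.2 fun i => (hexp (w i)).const_mul (a i)
  have hM : HasFDerivAt (mixedMonomial m) (fderiv ℝ (mixedMonomial m) a)
      (a * fun i => Complex.exp ((0 : ℝ) * w i)) := by
    have h0 : (a * fun i => Complex.exp ((0 : ℝ) * w i)) = a := by ext i; simp
    rw [h0]
    exact ((contDiff_mixedMonomial m).differentiable one_ne_zero a).hasFDerivAt
  refine (hM.comp_hasDerivAt 0 hcurve).unique ?_
  have hcomp : mixedMonomial m ∘ (fun t : ℝ => a * fun i => Complex.exp (t * w i)) =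
      fun t : ℝ => mixedMonomial m a * Complex.exp (t * logForm m w) := by
    ext t
    rw [← logForm_ofReal_smul, ← mixedMonomial_exp, ← mixedMonomial_mul]
    rfl
  rw [hcomp]
  exact (hexp _).const_mul _

theorem fderiv_value_mul {f : MixedPolynomial n} {s : Finset (Fin n ⊕ Fin n →₀ ℕ)}
    (hs : f.support ⊆ s) (a w : Fin n → ℂ) :
    fderiv ℝ (value f) a (a * w) = ∑ m ∈ s, f.coeff m * (mixedMonomial m a * logForm m w) := by
  have hdiff (m : Fin n ⊕ Fin n →₀ ℕ) : DifferentiableAt ℝ (mixedMonomial m) a :=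
    (contDiff_mixedMonomial m).differentiable one_ne_zero a
  rw [funext (value_eq_sum hs), fderiv_fun_sum fun m _ => (hdiff m).const_mul _,
    _root_.sum_apply]
  refine Finset.sum_congr rfl fun m _ => ?_
  rw [fderiv_const_mul (hdiff m), _root_.smul_apply, fderiv_mixedMonomial_mul,
    smul_eq_mul]

open Classical in
theorem coeff_faceFunction (f : MixedPolynomial n) (Δ : Set (Fin n → ℝ))
    (m : Fin n ⊕ Fin n →₀ ℕ) :
    (faceFunction f Δ).coeff m = if totalExponent m ∈ Δ then f.coeff m else 0 := by
  simp only [faceFunction, MvPolynomial.coeff_sum, MvPolynomial.coeff_monomial,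
    Finset.sum_ite_eq', Finset.mem_filter, MvPolynomial.mem_support_iff]
  by_cases hm : f.coeff m = 0 <;> simp [hm]

theorem mem_support_faceFunction {f : MixedPolynomial n} {Δ : Set (Fin n → ℝ)}
    {m : Fin n ⊕ Fin n →₀ ℕ} :
    m ∈ (faceFunction f Δ).support ↔ m ∈ f.support ∧ totalExponent m ∈ Δ := by
  classical
  rw [MvPolynomial.mem_support_iff, MvPolynomial.mem_support_iff, coeff_faceFunction]
  split_ifs <;> simp_all

theorem support_faceFunction_subset (f : MixedPolynomial n) (Δ : Set (Fin n → ℝ)) :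
    (faceFunction f Δ).support ⊆ f.support :=
  fun _ hm => (mem_support_faceFunction.1 hm).1

theorem newtonPolygon_eq_add (f : MixedPolynomial n) :
    newtonPolygon f = convexHull ℝ (totalExponent '' f.support) + Set.Ici (0 : Fin n → ℝ) := by
  have horthants : (⋃ m ∈ f.support, {ξ : Fin n → ℝ | ∀ i, totalExponent m i ≤ ξ i}) =
      totalExponent '' (f.support : Set (Fin n ⊕ Fin n →₀ ℕ)) + Set.Ici (0 : Fin n → ℝ) := by
    rw [← Set.iUnion_add_left_image, Set.biUnion_image]
    simp only [Set.image_const_add_Ici, add_zero]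
    rfl
  rw [newtonPolygon, horthants, convexHull_add, (convex_Ici 0).convexHull_eq]

theorem weightFunction_add (P ξ η : Fin n → ℝ) :
    weightFunction P (ξ + η) = weightFunction P ξ + weightFunction P η :=
  dotProduct_add P ξ η

theorem totalExponent_mem_newtonPolygon {f : MixedPolynomial n} {m : Fin n ⊕ Fin n →₀ ℕ}
    (hm : m ∈ f.support) : totalExponent m ∈ newtonPolygon f :=
  subset_convexHull _ _ (Set.mem_biUnion hm fun _ => le_rfl)

theorem le_weightFunction_of_mem_newtonPolygon {f : MixedPolynomial n} {P : Fin n → ℝ}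
    (hP : 0 ≤ P) {d : ℝ} (hd : ∀ m ∈ f.support, d ≤ weightFunction P (totalExponent m))
    {ξ : Fin n → ℝ} (hξ : ξ ∈ newtonPolygon f) : d ≤ weightFunction P ξ := by
  have hlin : IsLinearMap ℝ (weightFunction P) :=
    ⟨dotProduct_add P, fun c η => dotProduct_smul c P η⟩
  refine convexHull_min (Set.iUnion₂_subset fun m hm η hη => ?_) (convex_halfSpace_ge hlin d) hξ
  exact (hd m hm).trans (dotProduct_le_dotProduct_of_nonneg_left hη hP)

theorem totalExponent_mem_faceOfWeight_iff {f : MixedPolynomial n} {P : Fin n → ℝ}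
    (hP : 0 ≤ P) {m : Fin n ⊕ Fin n →₀ ℕ} (hm : m ∈ f.support) :
    totalExponent m ∈ faceOfWeight f P ↔ ∀ m' ∈ f.support,
      weightFunction P (totalExponent m) ≤ weightFunction P (totalExponent m') :=
  ⟨fun h _ hm' => h.2 _ (totalExponent_mem_newtonPolygon hm'), fun h =>
    ⟨totalExponent_mem_newtonPolygon hm, fun _ hη =>
      le_weightFunction_of_mem_newtonPolygon hP h hη⟩⟩

theorem exists_totalExponent_mem_faceOfWeight {f : MixedPolynomial n} (hf : f ≠ 0)
    {P : Fin n → ℝ} (hP : 0 ≤ P) : ∃ m ∈ f.support, totalExponent m ∈ faceOfWeight f P := by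
  obtain ⟨m, hm, hmin⟩ := f.support.exists_min_image
    (fun m => weightFunction P (totalExponent m)) (MvPolynomial.support_nonempty.2 hf)
  exact ⟨m, hm, (totalExponent_mem_faceOfWeight_iff hP hm).2 hmin⟩

theorem add_mem_faceOfWeight {f : MixedPolynomial n} {P ξ ζ : Fin n → ℝ}
    (hξ : ξ ∈ faceOfWeight f P) (hζ : 0 ≤ ζ) (hPζ : weightFunction P ζ = 0) :
    ξ + ζ ∈ faceOfWeight f P := by
  refine ⟨?_, fun η hη => ?_⟩
  · have hξN := hξ.1
    rw [newtonPolygon_eq_add] at hξN ⊢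
    obtain ⟨η, hη, ζ', hζ', rfl⟩ := hξN
    exact ⟨η, hη, ζ' + ζ, add_nonneg hζ' hζ, (add_assoc _ _ _).symm⟩
  · rw [weightFunction_add, hPζ, add_zero]
    exact hξ.2 η hη

theorem faceOfWeight_subset_convexHull (f : MixedPolynomial n) {P : Fin n → ℝ}
    (hP : ∀ i, 0 < P i) : faceOfWeight f P ⊆ convexHull ℝ (totalExponent '' f.support) := by
  rintro ξ ⟨hξ, hmin⟩
  rw [newtonPolygon_eq_add] at hξ hmin
  obtain ⟨η, hη, ζ, hζ, rfl⟩ := hξ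
  have hle := hmin η ⟨η, hη, 0, Set.self_mem_Ici, add_zero η⟩
  have hterm : ∀ i ∈ Finset.univ, 0 ≤ P i * ζ i := fun i _ => mul_nonneg (hP i).le (hζ i)
  have hPζ : ∑ i, P i * ζ i = 0 :=
    (by simpa [weightFunction_add] using hle : weightFunction P ζ ≤ 0).antisymm
      (Finset.sum_nonneg hterm)
  have hζ0 : ζ = 0 := funext fun i =>
    (mul_eq_zero.1 ((Finset.sum_eq_zero_iff_of_nonneg hterm).1 hPζ i (Finset.mem_univ i))
      ).resolve_left (hP i).ne'
  simpa [hζ0] using hη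

theorem isCompactFace_faceOfWeight (f : MixedPolynomial n) {P : Fin n → ℝ}
    (hP : ∀ i, 0 < P i) : IsCompactFace f (faceOfWeight f P) := by
  refine ⟨⟨P, fun i => (hP i).le, rfl⟩, ?_⟩
  have hcont : Continuous (weightFunction P) := by unfold weightFunction; fun_prop
  have heq : faceOfWeight f P = convexHull ℝ (totalExponent '' f.support) ∩
      {ξ | ∀ η ∈ newtonPolygon f, weightFunction P ξ ≤ weightFunction P η} := by
    refine Set.Subset.antisymm
      (fun ξ hξ => ⟨faceOfWeight_subset_convexHull f hP hξ, hξ.2⟩) fun ξ hξ => ⟨?_, hξ.2⟩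
    rw [newtonPolygon_eq_add]
    exact ⟨ξ, hξ.1, 0, Set.self_mem_Ici, add_zero ξ⟩
  rw [heq]
  refine ((f.support.finite_toSet.image _).isCompact_convexHull ℝ).inter_right ?_
  simp only [Set.ofPred_forall]
  exact isClosed_biInter fun η _ => isClosed_le hcont continuous_const

theorem isEssentialNoncompactFace_faceOfWeight {f : MixedPolynomial n} (hf : f ≠ 0)
    {I : Finset (Fin n)} (hI : I.Nonempty) (hv : VanishesOn f I) {P : Fin n → ℝ}
    (hP : 0 ≤ P) (hPI : ∀ i, i ∈ I ↔ P i = 0) :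
    IsEssentialNoncompactFace f I (faceOfWeight f P) := by
  have hray : ∀ i ∈ I, ∀ ξ ∈ faceOfWeight f P, ∀ t : ℝ, 0 ≤ t →
      ξ + t • Pi.single i (1 : ℝ) ∈ faceOfWeight f P := fun i hi ξ hξ t ht =>
    add_mem_faceOfWeight hξ (smul_nonneg ht (Pi.single_nonneg.2 zero_le_one)) <| by
      change P ⬝ᵥ (t • Pi.single i (1 : ℝ)) = 0
      rw [dotProduct_smul, dotProduct_single, (hPI i).1 hi, zero_mul, smul_zero]
  refine ⟨P, hP, hPI, rfl, fun hcompact => ?_, hv, hray⟩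
  obtain ⟨i, hi⟩ := hI
  obtain ⟨m, -, hm⟩ := exists_totalExponent_mem_faceOfWeight hf hP
  obtain ⟨C, hC⟩ := (hcompact.image (continuous_apply i)).bddAbove
  have hle := hC ⟨_, hray i hi _ hm (|C| + 1) (by positivity), rfl⟩
  have h0 : 0 ≤ totalExponent m i := totalExponent_nonneg m i
  simp only [Pi.add_apply, Pi.smul_apply, Pi.single_eq_same, smul_eq_mul, mul_one] at hle
  linarith [le_abs_self C]

/-- The part of strong non-degeneracy that concerns the compact faces of the Newton polygon. -/
def NondegenerateOnCompactFaces (f : MixedPolynomial n) : Prop :=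
  ∀ Δ, IsCompactFace f Δ → NoCriticalPointOnTorus (faceFunction f Δ)

theorem NondegenerateOnCompactFaces.ne_zero {f : MixedPolynomial n}
    (hnd : NondegenerateOnCompactFaces f) : f ≠ 0 := by
  rintro rfl
  have hface := isCompactFace_faceOfWeight (0 : MixedPolynomial n) (P := 1) fun _ => one_pos
  obtain ⟨w, hw⟩ := not_not.1 (hnd _ hface 1 fun _ => one_ne_zero) 1
  have hvalue : value (faceFunction (0 : MixedPolynomial n) (faceOfWeight 0 1)) = fun _ => 0 :=
    funext fun z => by simp [faceFunction, value]
  simp [hvalue] at hw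

/-! ### Degeneration to compact faces -/

theorem exists_weight_of_tendsto_atTop {α : Type*} {f : MixedPolynomial n} (hf : f ≠ 0)
    (𝒰 : Ultrafilter α) {x : α → Fin n → ℝ} (hx : ∀ i, Tendsto (fun t => x t i) 𝒰 atTop) :
    ∃ (β P : Fin n → ℝ) (h : α → ℝ), (∀ i, 0 < P i) ∧ ∀ m ∈ f.support,
      (totalExponent m ∈ faceOfWeight f P →
        Tendsto (fun t => weightFunction (x t) (totalExponent m) - h t) 𝒰
          (𝓝 (weightFunction β (totalExponent m)))) ∧
      (totalExponent m ∉ faceOfWeight f P →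
        Tendsto (fun t => weightFunction (x t) (totalExponent m) - h t) 𝒰 atTop) := by
  -- Weights are compared with that of a monomial of eventually least weight: such a difference is
  -- bounded below, so along the ultrafilter it converges or tends to infinity.
  obtain ⟨m₀, hm₀, hmin⟩ := exists_eventually_forall_le 𝒰 (MvPolynomial.support_nonempty.2 hf)
    fun t m => weightFunction (x t) (totalExponent m)
  let ℓ : Fin n ⊕ f.support → (Fin n → ℝ) →ₗ[ℝ] ℝ := Sum.elim LinearMap.proj fun m =>
    Fintype.linearCombination ℝ (totalExponent m.1 - totalExponent m₀)
  have hℓ (m : f.support) (y : Fin n → ℝ) : ℓ (.inr m) y =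
      weightFunction y (totalExponent m) - weightFunction y (totalExponent m₀) :=
    dotProduct_sub y _ _
  let S : Set (Fin n ⊕ f.support) := {j | ∃ c, Tendsto (fun t => ℓ j (x t)) 𝒰 (𝓝 c)}
  have hcoord (i : Fin n) : .inl i ∉ S := fun ⟨_, hc⟩ =>
    not_tendsto_nhds_of_tendsto_atTop (hx i) _ hc
  have hdiv : ∀ j ∉ S, Tendsto (fun t => ℓ j (x t)) 𝒰 atTop := by
    rintro (i | m) hj
    · exact hx i
    · refine (exists_tendsto_nhds_or_tendsto_atTop 𝒰 (c := 0) ?_).resolve_left hj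
      filter_upwards [hmin] with t ht
      exact (hℓ m _).symm ▸ sub_nonneg.2 (ht m m.2)
  obtain ⟨β, P, hS, hSc⟩ := exists_recession_direction ℓ (fun _ hj => hj) hdiv
  have hP (i : Fin n) : 0 < P i := hSc _ (hcoord i)
  have hface (m : f.support) : totalExponent m.1 ∈ faceOfWeight f P ↔ .inr m ∈ S := by
    rw [totalExponent_mem_faceOfWeight_iff (fun i => (hP i).le) m.2]
    refine ⟨fun hm => not_imp_comm.1 (hSc _) ?_, fun hm m' hm' => ?_⟩
    · exact not_lt.2 ((hℓ m P).symm ▸ sub_nonpos.2 (hm m₀ hm₀))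
    · rw [sub_eq_zero.1 ((hℓ m P).symm.trans (hS _ hm).1), ← sub_nonneg, ← hℓ ⟨m', hm'⟩]
      by_cases hm'S : .inr ⟨m', hm'⟩ ∈ S
      · exact (hS _ hm'S).1.ge
      · exact (hSc _ hm'S).le
  refine ⟨β, P, fun t => weightFunction (x t) (totalExponent m₀) - weightFunction β
    (totalExponent m₀), hP, fun m hm => ⟨fun hmP => ?_, fun hmP => ?_⟩⟩
  · have hlim := (hS _ ((hface ⟨m, hm⟩).1 hmP)).2
    simp only [hℓ] at hlim
    convert hlim.add_const (weightFunction β (totalExponent m₀)) using 2 <;> ring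
  · have hlim := hdiv _ (mt (hface ⟨m, hm⟩).2 hmP)
    simp only [hℓ] at hlim
    refine (tendsto_atTop_add_const_right _ (weightFunction β (totalExponent m₀)) hlim).congr
      fun t => by ring

theorem mixedMonomial_eq_exp_mul_phase (m : Fin n ⊕ Fin n →₀ ℕ) {z : Fin n → ℂ}
    (hz : ∀ i, z i ≠ 0) : mixedMonomial m z =
      (Real.exp (weightFunction (fun i => Real.log ‖z i‖) (totalExponent m)) : ℂ) *
        mixedMonomial m fun i => z i / ‖z i‖ := by
  rw [← mixedMonomial_exp_ofReal, ← mixedMonomial_mul]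
  congr 1
  ext i
  rw [Pi.mul_apply, Real.exp_log (norm_pos_iff.2 (hz i)),
    mul_div_cancel₀ _ (Complex.ofReal_ne_zero.2 (norm_ne_zero_iff.2 (hz i)))]

open Classical in
/-- Along `l`, the monomials of `f` at the points `a t`, rescaled by the real factors `s t`, tend to
the monomials of the face function `f_Δ` at `b`. -/
def DegeneratesTo {α : Type*} (f : MixedPolynomial n) (l : Filter α) (a : α → Fin n → ℂ)
    (s : α → ℝ) (Δ : Set (Fin n → ℝ)) (b : Fin n → ℂ) : Prop :=
  ∀ m ∈ f.support, Tendsto (fun t => (s t : ℂ) * mixedMonomial m (a t)) l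
    (𝓝 (if totalExponent m ∈ Δ then mixedMonomial m b else 0))

theorem DegeneratesTo.tendsto_smul_fderiv {α : Type*} {f : MixedPolynomial n} {l : Filter α}
    {a : α → Fin n → ℂ} {s : α → ℝ} {Δ : Set (Fin n → ℝ)} {b : Fin n → ℂ}
    (h : DegeneratesTo f l a s Δ b) (w : Fin n → ℂ) :
    Tendsto (fun t => s t • fderiv ℝ (value f) (a t) (a t * w)) l
      (𝓝 (fderiv ℝ (value (faceFunction f Δ)) b (b * w))) := by
  have hsum := tendsto_finsetSum f.support fun m hm =>
    ((h m hm).mul_const (logForm m w)).const_mul (f.coeff m)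
  convert hsum using 2 with t
  · rw [fderiv_value_mul subset_rfl, Complex.real_smul, Finset.mul_sum]
    exact Finset.sum_congr rfl fun m _ => by ring
  · rw [fderiv_value_mul (support_faceFunction_subset f Δ)]
    refine Finset.sum_congr rfl fun m _ => ?_
    rw [coeff_faceFunction]
    split_ifs <;> simp

theorem DegeneratesTo.of_norm_sub_le {α : Type*} {f : MixedPolynomial n} {l : Filter α}
    {a z : α → Fin n → ℂ} {s : α → ℝ} {Δ : Set (Fin n → ℝ)} {b : Fin n → ℂ}
    (h : DegeneratesTo f l z s Δ b) {ε : α → ℝ} (hε : Tendsto ε l (𝓝 0))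
    (hza : ∀ t, ∀ m ∈ f.support, ‖mixedMonomial m (z t) - mixedMonomial m (a t)‖ ≤
      ε t * ∑ k ∈ f.support, ‖mixedMonomial k (z t)‖) :
    DegeneratesTo f l a s Δ b := by
  intro m hm
  have hsum := tendsto_finsetSum f.support fun k hk => (h k hk).norm
  have herr : Tendsto (fun t => (s t : ℂ) * (mixedMonomial m (a t) - mixedMonomial m (z t))) l
      (𝓝 0) := by
    refine squeeze_zero_norm (fun t => ?_) (by simpa only [zero_mul] using hε.mul hsum)
    simp only [norm_mul]
    rw [← Finset.mul_sum, mul_left_comm, norm_sub_rev]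
    exact mul_le_mul_of_nonneg_left (hza t m hm) (norm_nonneg _)
  simpa [mul_sub] using herr.add (h m hm)

theorem exists_degeneration_of_torus {α : Type*} {f : MixedPolynomial n} (hf : f ≠ 0)
    (𝒰 : Ultrafilter α) {a : α → Fin n → ℂ} (ha : Tendsto a 𝒰 (𝓝 0)) (hne : ∀ t i, a t i ≠ 0) :
    ∃ (P : Fin n → ℝ) (b : Fin n → ℂ) (s : α → ℝ), (∀ i, 0 < P i) ∧ (∀ i, b i ≠ 0) ∧
      DegeneratesTo f 𝒰 a s (faceOfWeight f P) b := by
  let x (t : α) (i : Fin n) : ℝ := -Real.log ‖a t i‖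
  let u (t : α) (i : Fin n) : ℂ := a t i / ‖a t i‖
  have hx (i : Fin n) : Tendsto (fun t => x t i) 𝒰 atTop := by
    refine tendsto_neg_atBot_atTop.comp (Real.tendsto_log_nhdsGT_zero.comp ?_)
    refine tendsto_nhdsWithin_iff.2 ⟨?_, .of_forall fun t => norm_pos_iff.2 (hne t i)⟩
    simpa using (tendsto_pi_nhds.1 ha i).norm
  obtain ⟨β, P, h, hP, hlim⟩ := exists_weight_of_tendsto_atTop hf 𝒰 hx
  have hu (t : α) (i : Fin n) : ‖u t i‖ = 1 := by
    simp [u, norm_ne_zero_iff.2 (hne t i)]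
  obtain ⟨u', hu', hlimu⟩ := (isCompact_univ_pi fun _ : Fin n => isCompact_sphere (0 : ℂ) 1
    ).ultrafilter_le_nhds' (𝒰.map u) (Eventually.of_forall (f := (𝒰 : Filter α))
      fun t i _ => mem_sphere_zero_iff_norm.2 (hu t i))
  refine ⟨P, (fun i => (Real.exp (-β i) : ℂ)) * u', fun t => Real.exp (h t), hP, fun i => ?_,
    fun m hm => ?_⟩
  · have hui : ‖u' i‖ = 1 := mem_sphere_zero_iff_norm.1 (hu' i trivial)
    exact mul_ne_zero (Complex.ofReal_ne_zero.2 (Real.exp_ne_zero _))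
      (norm_ne_zero_iff.1 (hui ▸ one_ne_zero))
  have hsM (t : α) : (Real.exp (h t) : ℂ) * mixedMonomial m (a t) =
      (Real.exp (-(weightFunction (x t) (totalExponent m) - h t)) : ℂ) * mixedMonomial m (u t) := by
    rw [mixedMonomial_eq_exp_mul_phase m (hne t), ← mul_assoc, ← Complex.ofReal_mul,
      ← Real.exp_add, show weightFunction (x t) (totalExponent m) = _ from neg_dotProduct _ _,
      neg_sub, sub_neg_eq_add]
    rfl
  have hMu : Tendsto (fun t => mixedMonomial m (u t)) 𝒰 (𝓝 (mixedMonomial m u')) :=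
    ((contDiff_mixedMonomial m (k := 0)).continuous.tendsto u').comp hlimu
  simp only [hsM]
  split_ifs with hmP
  · rw [mixedMonomial_mul, mixedMonomial_exp_ofReal m fun i => -β i]
    refine Tendsto.mul ((Complex.continuous_ofReal.tendsto _).comp
      ((Real.continuous_exp.tendsto _).comp ?_)) hMu
    rw [show weightFunction (fun i => -β i) (totalExponent m) =
      -weightFunction β (totalExponent m) from neg_dotProduct _ _]
    exact ((hlim m hm).1 hmP).neg
  · simpa using Tendsto.mul ((Complex.continuous_ofReal.tendsto _).comp
      (Real.tendsto_exp_neg_atTop_nhds_zero.comp ((hlim m hm).2 hmP))) hMu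

theorem exists_torus_point_near {s : Finset (Fin n ⊕ Fin n →₀ ℕ)} {a : Fin n → ℂ} (ha : a ≠ 0)
    (hs : ∃ m ∈ s, mixedMonomial m a ≠ 0) :
    ∃ z : Fin n → ℂ, (∀ i, z i ≠ 0) ∧ ‖z - a‖ < ‖a‖ ∧ ∀ m ∈ s,
      ‖mixedMonomial m z - mixedMonomial m a‖ < ‖a‖ * ∑ k ∈ s, ‖mixedMonomial k z‖ := by
  have hcont (m : Fin n ⊕ Fin n →₀ ℕ) : ContinuousAt (mixedMonomial m) a :=
    (contDiff_mixedMonomial m (k := 0)).continuous.continuousAt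
  have hpos : 0 < ‖a‖ * ∑ k ∈ s, ‖mixedMonomial k a‖ := by
    obtain ⟨m, hm, hma⟩ := hs
    exact mul_pos (norm_pos_iff.2 ha)
      (Finset.sum_pos' (fun _ _ => norm_nonneg _) ⟨m, hm, norm_pos_iff.2 hma⟩)
  have hclose : ∀ᶠ z in 𝓝 a, ∀ m ∈ s,
      ‖mixedMonomial m z - mixedMonomial m a‖ < ‖a‖ * ∑ k ∈ s, ‖mixedMonomial k z‖ := by
    refine (Filter.eventually_all_finset s).2 fun m _ => ContinuousAt.eventually_lt
      ((hcont m).sub continuousAt_const).norm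
      (continuousAt_const.mul (tendsto_finsetSum _ fun k _ => (hcont k).norm)) ?_
    simpa using hpos
  have hdense : Dense (Set.univ.pi fun _ : Fin n => ({0}ᶜ : Set ℂ)) :=
    dense_pi _ fun _ _ => dense_compl_singleton 0
  obtain ⟨z, hz0, hza, hz⟩ := hdense.inter_nhds_nonempty
    (inter_mem (Metric.ball_mem_nhds a (norm_pos_iff.2 ha)) hclose)
  exact ⟨z, fun i => hz0 i trivial, by simpa [dist_eq_norm] using hza, hz⟩

theorem exists_degeneration {α : Type*} {f : MixedPolynomial n} (hf : f ≠ 0)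
    (𝒰 : Ultrafilter α) {a : α → Fin n → ℂ} (ha : Tendsto a 𝒰 (𝓝 0)) (hne : ∀ t, a t ≠ 0)
    (hM : ∀ t, ∃ m ∈ f.support, mixedMonomial m (a t) ≠ 0) :
    ∃ (P : Fin n → ℝ) (b : Fin n → ℂ) (s : α → ℝ), (∀ i, 0 < P i) ∧ (∀ i, b i ≠ 0) ∧
      DegeneratesTo f 𝒰 a s (faceOfWeight f P) b := by
  choose z hz0 hza hclose using fun t => exists_torus_point_near (hne t) (hM t)
  have hnorm : Tendsto (fun t => ‖a t‖) 𝒰 (𝓝 0) := by simpa using ha.norm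
  have hz : Tendsto z 𝒰 (𝓝 0) := by
    simpa using (squeeze_zero_norm (fun t => (hza t).le) hnorm).add ha
  obtain ⟨P, b, s, hP, hb, hdeg⟩ := exists_degeneration_of_torus hf 𝒰 hz hz0
  exact ⟨P, b, s, hP, hb, hdeg.of_norm_sub_le hnorm fun t m hm => (hclose t m hm).le⟩

theorem eventually_surjective_fderiv_value {f : MixedPolynomial n}
    (hnd : NondegenerateOnCompactFaces f) :
    ∀ᶠ a in 𝓝 0, a ≠ 0 → (∃ m ∈ f.support, mixedMonomial m a ≠ 0) →
      Function.Surjective (fderiv ℝ (value f) a) := by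
  by_contra hbad
  let bad : Set (Fin n → ℂ) := {a | a ≠ 0 ∧ (∃ m ∈ f.support, mixedMonomial m a ≠ 0) ∧
    ¬ Function.Surjective (fderiv ℝ (value f) a)}
  have hfreq : ∃ᶠ a in 𝓝 0, a ∈ bad := (not_eventually.1 hbad).mono fun a ha => by
    simpa only [bad, Set.mem_ofPred_eq, Classical.not_imp] using ha
  have := mem_closure_iff_comap_neBot.1 (mem_closure_iff_frequently.2 hfreq)
  let 𝒰 := Ultrafilter.of (comap ((↑) : bad → Fin n → ℂ) (𝓝 0))
  have h𝒰 : Tendsto ((↑) : bad → Fin n → ℂ) 𝒰 (𝓝 0) :=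
    tendsto_comap.mono_left (Ultrafilter.of_le _)
  obtain ⟨P, b, s, hP, hb, hdeg⟩ := exists_degeneration hnd.ne_zero 𝒰 h𝒰 (fun t => t.2.1)
    fun t => t.2.2.1
  have hface := not_not.1 (hnd _ (isCompactFace_faceOfWeight f hP) b hb)
  let L (a : bad) : (Fin n → ℂ) →ₗ[ℝ] ℂ :=
    s a • (fderiv ℝ (value f) a).toLinearMap ∘ₗ LinearMap.mulLeft ℝ a.1
  let L₀ : (Fin n → ℂ) →ₗ[ℝ] ℂ :=
    (fderiv ℝ (value (faceFunction f (faceOfWeight f P))) b).toLinearMap ∘ₗ LinearMap.mulLeft ℝ b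
  have hL (w : Fin n → ℂ) : Tendsto (fun a => L a w) 𝒰 (𝓝 (L₀ w)) := hdeg.tendsto_smul_fderiv w
  have hL₀ : Function.Surjective L₀ :=
    hface.comp fun v => ⟨b⁻¹ * v, funext fun i => mul_inv_cancel_left₀ (hb i) (v i)⟩
  obtain ⟨a, ha⟩ := (eventually_surjective_of_tendsto hL hL₀).exists
  refine a.2.2.2 fun v => ?_
  obtain ⟨w, hw⟩ := ha v
  exact ⟨s a • (a.1 * w), by rw [map_smul]; exact hw⟩

/-! ### Radial deformation near vanishing coordinate subspaces -/

/-- Arbitrarily close to `a`, the function `g` takes values on every open ray of `ℂ` that starts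
at the origin. -/
def HitsEveryRayNear {X : Type*} [TopologicalSpace X] (g : X → ℂ) (a : X) : Prop :=
  ∀ b : ℂ, b ≠ 0 → ∃ᶠ z in 𝓝 a, ∃ s : ℝ, 0 < s ∧ g z = s * b

theorem hitsEveryRayNear_of_surjective {E : Type*} [NormedAddCommGroup E] [NormedSpace ℝ E]
    [CompleteSpace E] {g : E → ℂ} {g' : E →L[ℝ] ℂ} {a : E} (hg : HasStrictFDerivAt g g' a)
    (hsurj : Function.Surjective g') (ha : g a = 0) : HitsEveryRayNear g a := by
  intro b _
  have hray : Tendsto (fun s : ℝ => (s : ℂ) * b) (𝓝[>] 0) (𝓝 0) := by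
    have hcont : Continuous fun s : ℝ => (s : ℂ) * b := by fun_prop
    simpa using (hcont.tendsto 0).mono_left nhdsWithin_le_nhds
  have hfreq : ∃ᶠ y in map g (𝓝 a), ∃ s : ℝ, 0 < s ∧ y = s * b := by
    rw [hg.map_nhds_eq_of_surj (LinearMap.range_eq_top.2 hsurj), ha]
    refine hray.frequently (Eventually.frequently ?_)
    filter_upwards [self_mem_nhdsWithin] with s hs
    exact ⟨s, hs, rfl⟩
  exact hfreq

/-- The radial degree of the mixed monomial with exponent `m` with respect to the weight `p`. -/
def radialDegree (p : Fin n → ℕ) (m : Fin n ⊕ Fin n →₀ ℕ) : ℕ :=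
  ∑ i, p i * (m (Sum.inl i) + m (Sum.inr i))

/-- The least radial degree of a monomial of `f`; it is `0` for `f = 0`. -/
noncomputable def minRadialDegree (f : MixedPolynomial n) (p : Fin n → ℕ) : ℕ :=
  sInf (radialDegree p '' f.support)

/-- The family `t ^ (-d) * f (t ^ p * z)`, where `d` is the least radial degree of `f`, written
without division so that it extends to `t = 0`, where it is the face function. -/
noncomputable def radialDeformation (f : MixedPolynomial n) (p : Fin n → ℕ) (t : ℝ)
    (z : Fin n → ℂ) : ℂ :=
  ∑ m ∈ f.support,
    f.coeff m * ((t : ℂ) ^ (radialDegree p m - minRadialDegree f p) * mixedMonomial m z)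

theorem weightFunction_natCast (p : Fin n → ℕ) (m : Fin n ⊕ Fin n →₀ ℕ) :
    weightFunction (fun i => (p i : ℝ)) (totalExponent m) = radialDegree p m := by
  simp [weightFunction, totalExponent, radialDegree]

theorem minRadialDegree_le {f : MixedPolynomial n} (p : Fin n → ℕ) {m : Fin n ⊕ Fin n →₀ ℕ}
    (hm : m ∈ f.support) : minRadialDegree f p ≤ radialDegree p m :=
  Nat.sInf_le (Set.mem_image_of_mem _ hm)

theorem totalExponent_mem_faceOfWeight_natCast_iff {f : MixedPolynomial n} {p : Fin n → ℕ}
    {m : Fin n ⊕ Fin n →₀ ℕ} (hm : m ∈ f.support) :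
    totalExponent m ∈ faceOfWeight f (fun i => (p i : ℝ)) ↔
      radialDegree p m = minRadialDegree f p := by
  rw [totalExponent_mem_faceOfWeight_iff (fun i => Nat.cast_nonneg _) hm]
  simp only [weightFunction_natCast, Nat.cast_le]
  refine ⟨fun h => (minRadialDegree_le p hm).antisymm' ?_, fun h m' hm' =>
    h ▸ minRadialDegree_le p hm'⟩
  exact le_csInf ⟨_, m, hm, rfl⟩ (Set.forall_mem_image.2 h)

theorem mixedMonomial_ofReal_pow (p : Fin n → ℕ) (m : Fin n ⊕ Fin n →₀ ℕ) (t : ℝ) :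
    mixedMonomial m (fun i => (t : ℂ) ^ p i) = (t : ℂ) ^ radialDegree p m := by
  simp only [mixedMonomial, radialDegree, ← Finset.prod_pow_eq_pow_sum, map_pow,
    Complex.conj_ofReal, ← pow_add, pow_mul]

theorem value_pow_mul (f : MixedPolynomial n) (p : Fin n → ℕ) (t : ℝ) (z : Fin n → ℂ) :
    value f ((fun i => (t : ℂ) ^ p i) * z) =
      (t : ℂ) ^ minRadialDegree f p * radialDeformation f p t z := by
  rw [value_eq_sum subset_rfl, radialDeformation, Finset.mul_sum]
  refine Finset.sum_congr rfl fun m hm => ?_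
  rw [mixedMonomial_mul, mixedMonomial_ofReal_pow,
    ← pow_mul_pow_sub (t : ℂ) (minRadialDegree_le p hm)]
  ring

theorem radialDeformation_zero (f : MixedPolynomial n) (p : Fin n → ℕ) (z : Fin n → ℂ) :
    radialDeformation f p 0 z =
      value (faceFunction f (faceOfWeight f fun i => (p i : ℝ))) z := by
  classical
  rw [value_eq_sum (support_faceFunction_subset f _), radialDeformation]
  refine Finset.sum_congr rfl fun m hm => ?_
  rw [coeff_faceFunction, totalExponent_mem_faceOfWeight_natCast_iff hm]
  split_ifs with h
  · simp [h]
  · have hlt := (minRadialDegree_le p hm).lt_of_ne' h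
    simp [(Nat.sub_pos_of_lt hlt).ne']

theorem contDiff_radialDeformation (f : MixedPolynomial n) (p : Fin n → ℕ) {k : WithTop ℕ∞} :
    ContDiff ℝ k fun q : ℝ × (Fin n → ℂ) => radialDeformation f p q.1 q.2 :=
  ContDiff.sum fun m _ => contDiff_const.mul <|
    ((Complex.ofRealCLM.contDiff.comp contDiff_fst).pow _).mul
      ((contDiff_mixedMonomial m).comp contDiff_snd)

theorem frequently_value_eq_mul_of_surjective {E : Type*} [NormedAddCommGroup E] [NormedSpace ℝ E]
    [CompleteSpace E] {f : MixedPolynomial n} {p : Fin n → ℕ} {γ : E → Fin n → ℂ}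
    (hγ : ContDiff ℝ 1 γ) {w₀ : E} (hsurj : Function.Surjective
      (fderiv ℝ (fun w => value (faceFunction f (faceOfWeight f fun i => (p i : ℝ))) (γ w)) w₀)) :
    ∃ᶠ z in 𝓝 ((fun i => (0 : ℂ) ^ p i) * γ w₀), ∃ s : ℝ, 0 < s ∧
      value f z = s * value (faceFunction f (faceOfWeight f fun i => (p i : ℝ))) (γ w₀) := by
  let F : ℝ × E → ℂ := fun q => radialDeformation f p q.1 (γ q.2)
  have hF : HasStrictFDerivAt F (fderiv ℝ F (0, w₀)) (0, w₀) :=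
    ((contDiff_radialDeformation f p).comp
      (contDiff_fst.prodMk (hγ.comp contDiff_snd))).hasStrictFDerivAt one_ne_zero
  have hslice : fderiv ℝ (fun w => F (0, w)) w₀ = (fderiv ℝ F (0, w₀)).comp (.inr ℝ ℝ E) :=
    (hF.hasFDerivAt.comp w₀ (hasFDerivAt_prodMk_right 0 w₀)).fderiv
  simp only [← radialDeformation_zero] at hsurj ⊢
  rw [hslice] at hsurj
  let Ψ : ℝ × E → Fin n → ℂ := fun q => (fun i => (q.1 : ℂ) ^ p i) * γ q.2
  have hΨ : Continuous Ψ := by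
    have := hγ.continuous
    fun_prop
  refine frequently_iff.2 fun {N} hN => ?_
  have hN' : Ψ ⁻¹' N ∈ 𝓝 (0, w₀) := hΨ.continuousAt.preimage_mem_nhds (by simpa [Ψ] using hN)
  have hsol := eventually_exists_eq_of_surjective hF hsurj hN'
  obtain ⟨t, ⟨w, hwN, hw⟩, ht⟩ := ((hsol.filter_mono nhdsWithin_le_nhds).and
    (self_mem_nhdsWithin (s := Set.Ioi (0 : ℝ)))).exists
  refine ⟨Ψ (t, w), hwN, t ^ minRadialDegree f p, pow_pos ht _, ?_⟩
  rw [value_pow_mul, Complex.ofReal_pow, ← show F (t, w) = radialDeformation f p 0 (γ w₀) from hw]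

theorem exists_generic_weight (s : Finset (Fin n ⊕ Fin n →₀ ℕ)) (I : Finset (Fin n)) :
    ∃ p : Fin n → ℕ, (∀ i, i ∈ I ↔ p i = 0) ∧ ∀ m ∈ s, ∀ m' ∈ s,
      radialDegree p m = radialDegree p m' → ∀ i ∉ I, totalExponent m i = totalExponent m' i := by
  classical
  let diff (m m' : Fin n ⊕ Fin n →₀ ℕ) (i : {i // i ∉ I}) : ℝ :=
    totalExponent m i - totalExponent m' i
  obtain ⟨q, hq, hgen⟩ := exists_pos_nat_dotProduct_ne_zero
    (((s ×ˢ s).image fun mm => diff mm.1 mm.2).erase 0) (Finset.notMem_erase 0 _)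
  let p (i : Fin n) : ℕ := if h : i ∈ I then 0 else q ⟨i, h⟩
  have hdegree (m : Fin n ⊕ Fin n →₀ ℕ) :
      (radialDegree p m : ℝ) = ∑ i : {i // i ∉ I}, (q i : ℝ) * totalExponent m i := by
    rw [← weightFunction_natCast, weightFunction,
      ← Fintype.sum_subtype_add_sum_subtype (· ∈ I)]
    refine (add_eq_right.2 (Finset.sum_eq_zero fun i _ => ?_)).trans
      (Finset.sum_congr rfl fun i _ => ?_)
    · simp [p, i.2]
    · simp [p, i.2]
  refine ⟨p, fun i => ?_, fun m hm m' hm' hdeg i hi => ?_⟩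
  · by_cases hi : i ∈ I <;> simp [p, hi, (hq _).ne']
  by_contra hne
  refine hgen (diff m m') (Finset.mem_erase.2 ⟨fun h0 => ?_, ?_⟩) ?_
  · exact hne (sub_eq_zero.1 (congrFun h0 ⟨i, hi⟩))
  · exact Finset.mem_image.2 ⟨(m, m'), Finset.mk_mem_product hm hm', rfl⟩
  · simp only [dotProduct, diff, mul_sub, Finset.sum_sub_distrib, ← hdegree, hdeg, sub_self]

section Stratum

variable {I : Finset (Fin n)}

theorem contDiff_glue (u : {i // i ∈ I} → ℂ) {k : WithTop ℕ∞} : ContDiff ℝ k (glue u) := by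
  refine contDiff_pi.2 fun i => ?_
  by_cases h : i ∈ I
  · simp only [glue, dif_pos h]
    exact contDiff_const
  · simp only [glue, dif_neg h]
    exact contDiff_apply ℝ ℂ _

theorem value_glue_exp_mul {g : MixedPolynomial n} {e : Fin n → ℝ}
    (hg : ∀ m ∈ g.support, ∀ i ∉ I, totalExponent m i = e i) {x : Fin n → ℝ}
    (hx : ∀ i ∈ I, x i = 0) (u : {i // i ∈ I} → ℂ) (w : {i // i ∉ I} → ℂ) :
    value g (glue u fun k => (Real.exp (x k) : ℂ) * w k) =
      Real.exp (weightFunction x e) * value g (glue u w) := by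
  have hdegree : ∀ m ∈ g.support, weightFunction x (totalExponent m) = weightFunction x e := by
    refine fun m hm => Finset.sum_congr rfl fun i _ => ?_
    by_cases hi : i ∈ I
    · rw [hx i hi, zero_mul, zero_mul]
    · rw [hg m hm i hi]
  rw [← value_exp_mul hdegree]
  congr 1
  ext i
  by_cases hi : i ∈ I <;> simp [glue, hi, hx]

theorem image_value_glue_torus {g : MixedPolynomial n} {e : Fin n → ℝ}
    (hg : ∀ m ∈ g.support, ∀ i ∉ I, totalExponent m i = e i) {k : Fin n} (hk : k ∉ I)
    (hek : e k ≠ 0) (u : {i // i ∈ I} → ℂ) :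
    (fun w => value g (glue u w)) '' {w | ∀ i, w i ≠ 0} =
      Set.Ioi (0 : ℝ) • (fun w => value g (glue u w)) ''
        Set.univ.pi fun _ => Metric.sphere (0 : ℂ) 1 := by
  refine Set.Subset.antisymm ?_ ?_
  · rintro _ ⟨w, hw, rfl⟩
    let x (i : Fin n) : ℝ := Real.log ‖glue (I := I) 1 w i‖
    have hx : ∀ i ∈ I, x i = 0 := fun i hi => by simp [x, glue, hi]
    have hexp (i : {i // i ∉ I}) : Real.exp (x i) = ‖w i‖ := by
      simp [x, glue, i.2, Real.exp_log (norm_pos_iff.2 (hw i))]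
    have hw0 (i : {i // i ∉ I}) : (‖w i‖ : ℂ) ≠ 0 :=
      Complex.ofReal_ne_zero.2 (norm_ne_zero_iff.2 (hw i))
    refine ⟨Real.exp (weightFunction x e), Real.exp_pos _, _,
      ⟨fun i => w i / ‖w i‖, fun i _ => by simp [hw i], rfl⟩, ?_⟩
    refine (value_glue_exp_mul hg hx u _).symm.trans ?_
    simp only [hexp, mul_div_cancel₀ _ (hw0 _)]
  · rintro _ ⟨s, hs, _, ⟨w, hw, rfl⟩, rfl⟩
    let x : Fin n → ℝ := Pi.single k (Real.log s / e k)
    have hx : ∀ i ∈ I, x i = 0 := fun i hi => Pi.single_eq_of_ne (ne_of_mem_of_not_mem hi hk) _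
    have hxe : Real.exp (weightFunction x e) = s := by
      rw [show weightFunction x e = _ from single_dotProduct _ _ _, div_mul_cancel₀ _ hek,
        Real.exp_log hs]
    refine ⟨fun i => (Real.exp (x i) : ℂ) * w i, fun i => mul_ne_zero
      (Complex.ofReal_ne_zero.2 (Real.exp_ne_zero _)) ?_, ?_⟩
    · exact ne_zero_of_mem_unit_sphere (⟨w i, hw i trivial⟩ : Metric.sphere (0 : ℂ) 1)
    · exact (value_glue_exp_mul hg hx u w).trans (by rw [hxe]; rfl)

theorem exists_value_glue_eq {g : MixedPolynomial n} {e : Fin n → ℝ}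
    (hg : ∀ m ∈ g.support, ∀ i ∉ I, totalExponent m i = e i) {k : Fin n} (hk : k ∉ I)
    (hek : e k ≠ 0) {u : {i // i ∈ I} → ℂ}
    (hreg : ∀ w : {i // i ∉ I} → ℂ, (∀ i, w i ≠ 0) →
      ¬ IsCriticalPoint (fun w' => value g (glue u w')) w) {b : ℂ} (hb : b ≠ 0) :
    ∃ w : {i // i ∉ I} → ℂ, (∀ i, w i ≠ 0) ∧ value g (glue u w) = b := by
  have hsmooth : ContDiff ℝ 1 fun w => value g (glue u w) :=
    (contDiff_value g).comp (contDiff_glue u)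
  have htorus : IsOpen {w : {i // i ∉ I} → ℂ | ∀ i, w i ≠ 0} := by
    simp only [Set.ofPred_forall]
    exact isOpen_iInter_of_finite fun i => isOpen_ne_fun (continuous_apply i) continuous_const
  have hopen := isOpen_image_of_surjective_fderiv hsmooth htorus fun w hw => not_not.1 (hreg w hw)
  have hcompact := (isCompact_univ_pi fun _ : {i // i ∉ I} =>
    isCompact_sphere (0 : ℂ) 1).image hsmooth.continuous
  rw [image_value_glue_torus hg hk hek] at hopen
  have hne : (Set.univ.pi fun _ : {i // i ∉ I} => Metric.sphere (0 : ℂ) 1).Nonempty :=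
    ⟨1, fun i _ => by simp⟩
  have hmem := compl_zero_subset_pos_smul (by simp) hcompact (hne.image _) hopen hb
  rwa [← image_value_glue_torus hg hk hek] at hmem

theorem eventually_not_isCriticalPoint_glue {f : MixedPolynomial n}
    (hnd : NondegenerateOnCompactFaces f) (htame : LocallyTame f) (hv : VanishesOn f I)
    {P : Fin n → ℝ} (hP : 0 ≤ P) (hPI : ∀ i, i ∈ I ↔ P i = 0) :
    ∀ᶠ a in 𝓝 (0 : Fin n → ℂ), (∀ i ∈ I, a i ≠ 0) → ∀ w : {i // i ∉ I} → ℂ, (∀ i, w i ≠ 0) →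
      ¬ IsCriticalPoint
        (fun w' => value (faceFunction f (faceOfWeight f P)) (glue (fun i => a i) w')) w := by
  rcases I.eq_empty_or_nonempty with rfl | hI
  · refine .of_forall fun a _ w hw => ?_
    have hface := hnd _ (isCompactFace_faceOfWeight f fun i =>
      (hP i).lt_of_ne' fun h => by simpa using (hPI i).2 h)
    let e : {i : Fin n // i ∉ (∅ : Finset (Fin n))} ≃ Fin n := Equiv.subtypeUnivEquiv (by simp)
    let L := ContinuousLinearEquiv.piCongrLeft ℝ (fun _ : Fin n => ℂ) e
    have hL : glue (fun i : {i // i ∈ (∅ : Finset (Fin n))} => a i) = L := by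
      ext w' i
      exact (Equiv.piCongrLeft_apply (fun _ : Fin n => ℂ) e w' i).symm
    have hcomp : (fun w' => value (faceFunction f (faceOfWeight f P)) (L w')) =
        value (faceFunction f (faceOfWeight f P)) ∘ L := rfl
    rw [hL, IsCriticalPoint, not_not, hcomp, L.comp_right_fderiv]
    refine (not_not.1 (hface (L w) fun i => ?_)).comp L.surjective
    exact hw (e.symm i)
  · obtain ⟨r, hr, hreg⟩ :=
      htame I hv _ (isEssentialNoncompactFace_faceOfWeight hnd.ne_zero hI hv hP hPI)
    have hcont : Continuous fun a : Fin n → ℂ => ∑ i : {i // i ∈ I}, ‖a i‖ ^ 2 := by fun_prop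
    have hsmall : ∀ᶠ a in 𝓝 (0 : Fin n → ℂ), ∑ i : {i // i ∈ I}, ‖a i‖ ^ 2 < r ^ 2 :=
      hcont.continuousAt.eventually_lt continuousAt_const (by simpa using pow_pos hr 2)
    filter_upwards [hsmall] with a ha haI w hw
    exact hreg _ (fun i => haI i i.2) ha.le w hw

theorem eventually_hitsEveryRayNear_of_vanishesOn {f : MixedPolynomial n}
    (hnd : NondegenerateOnCompactFaces f) (htame : LocallyTame f) (hv : VanishesOn f I)
    (hI : ∀ m ∈ f.support, ∃ k ∉ I, totalExponent m k ≠ 0) :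
    ∀ᶠ a in 𝓝 (0 : Fin n → ℂ), (∀ i, i ∈ I ↔ a i ≠ 0) → HitsEveryRayNear (value f) a := by
  obtain ⟨p, hpI, hgen⟩ := exists_generic_weight f.support I
  have hp : (0 : Fin n → ℝ) ≤ fun i => (p i : ℝ) := fun i => Nat.cast_nonneg _
  obtain ⟨m₀, hm₀, hm₀p⟩ := exists_totalExponent_mem_faceOfWeight hnd.ne_zero hp
  obtain ⟨k, hkI, hk⟩ := hI m₀ hm₀
  have hexponent : ∀ m ∈ (faceFunction f (faceOfWeight f fun i => (p i : ℝ))).support,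
      ∀ i ∉ I, totalExponent m i = totalExponent m₀ i := by
    intro m hm
    obtain ⟨hmf, hmp⟩ := mem_support_faceFunction.1 hm
    exact hgen m hmf m₀ hm₀ (((totalExponent_mem_faceOfWeight_natCast_iff hmf).1 hmp).trans
      ((totalExponent_mem_faceOfWeight_natCast_iff hm₀).1 hm₀p).symm)
  filter_upwards [eventually_not_isCriticalPoint_glue hnd htame hv hp
    fun i => (hpI i).trans Nat.cast_eq_zero.symm] with a ha haI b hb
  have hreg := ha fun i hi => (haI i).1 hi
  obtain ⟨w₀, hw₀, rfl⟩ := exists_value_glue_eq hexponent hkI hk hreg hb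
  have hlimit : ((fun i => (0 : ℂ) ^ p i) * glue (fun i : {i // i ∈ I} => a i) w₀) = a := by
    ext i
    by_cases hi : i ∈ I
    · simp [glue, hi, (hpI i).1 hi]
    · simp [mt (hpI i).2 hi, not_not.1 (mt (haI i).2 hi)]
  have hfreq := frequently_value_eq_mul_of_surjective (contDiff_glue _) (not_not.1 (hreg w₀ hw₀))
  rwa [hlimit] at hfreq

end Stratum

theorem eventually_hitsEveryRayNear_of_value_eq_zero {f : MixedPolynomial n}
    (hnd : NondegenerateOnCompactFaces f) (htame : LocallyTame f) :
    ∀ᶠ a in 𝓝 (0 : Fin n → ℂ), value f a = 0 → HitsEveryRayNear (value f) a := by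
  classical
  have hstrata : ∀ᶠ a in 𝓝 (0 : Fin n → ℂ), ∀ I : Finset (Fin n), VanishesOn f I →
      (∀ m ∈ f.support, ∃ k ∉ I, totalExponent m k ≠ 0) → (∀ i, i ∈ I ↔ a i ≠ 0) →
      HitsEveryRayNear (value f) a := by
    simp only [eventually_all]
    exact fun I hv hI => eventually_hitsEveryRayNear_of_vanishesOn hnd htame hv hI
  filter_upwards [hstrata, eventually_surjective_fderiv_value hnd] with a hstratum hsurj ha
  by_cases hM : ∃ m ∈ f.support, mixedMonomial m a ≠ 0
  · refine hitsEveryRayNear_of_surjective ((contDiff_value f).hasStrictFDerivAt one_ne_zero)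
      (hsurj (fun ha0 => ?_) hM) ha
    obtain ⟨m, hm, hma⟩ := hM
    rw [ha0, value_zero] at ha
    rw [ha0, mixedMonomial_zero_ne_zero_iff] at hma
    exact MvPolynomial.mem_support_iff.1 hm (hma ▸ ha)
  push Not at hM
  have hI : ∀ m ∈ f.support, ∃ k ∉ Finset.univ.filter (a · ≠ 0), totalExponent m k ≠ 0 :=
    fun m hm => by simpa using mixedMonomial_eq_zero_iff.1 (hM m hm)
  refine hstratum _ (fun z hz => ?_) hI (by simp)
  rw [value_eq_sum subset_rfl]
  refine Finset.sum_eq_zero fun m hm => ?_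
  obtain ⟨k, hk, hmk⟩ := hI m hm
  rw [mixedMonomial_eq_zero_iff.2 ⟨k, hz k hk, hmk⟩, mul_zero]

theorem mem_closure_milnorFiber {f : MixedPolynomial n} {r : ℝ} (θ : ℝ)
    {z₀ : EuclideanSpace ℂ (Fin n)} (hz₀ : z₀ ∈ Metric.ball 0 r)
    (hrays : HitsEveryRayNear (value f) fun i => z₀ i) : z₀ ∈ closure (milnorFiber f r θ) := by
  have htoLp : Tendsto (WithLp.toLp 2) (𝓝 fun i => z₀ i) (𝓝 z₀) :=
    (PiLp.continuous_toLp 2 _).tendsto _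
  have hfreq := hrays (Complex.exp (θ * Complex.I)) (Complex.exp_ne_zero _)
  refine mem_closure_iff_frequently.2 (htoLp.frequently ?_)
  refine (hfreq.and_eventually (htoLp (Metric.isOpen_ball.mem_nhds hz₀))).mono ?_
  rintro z ⟨⟨s, hs, hzs⟩, hzr⟩
  have hs0 : (s : ℂ) ≠ 0 := Complex.ofReal_ne_zero.2 hs.ne'
  refine ⟨⟨hzr, fun hzV => ?_⟩, ?_⟩
  · exact mul_ne_zero hs0 (Complex.exp_ne_zero _) (hzs.symm.trans hzV)
  · change value f z / (‖value f z‖ : ℂ) = _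
    rw [hzs, norm_mul, Complex.norm_exp_ofReal_mul_I, Complex.norm_real,
      Real.norm_of_nonneg hs.le, mul_one, mul_div_cancel_left₀ _ hs0]

end MixedMilnor

theorem mainTheorem5_general {n : ℕ} (f : MixedMilnor.MixedPolynomial n)
    (hnd : MixedMilnor.NondegenerateOnCompactFaces f) (htame : MixedMilnor.LocallyTame f) :
    ∃ r₀ : ℝ, 0 < r₀ ∧ ∀ r : ℝ, 0 < r → r ≤ r₀ → MixedMilnor.StableBoundary f r := by
  have hcoord : Continuous fun (z : EuclideanSpace ℂ (Fin n)) i => z i := by fun_prop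
  obtain ⟨r₀, hr₀, hrays⟩ := Metric.eventually_nhds_iff_ball.1 <| (hcoord.tendsto 0).eventually
    (MixedMilnor.eventually_hitsEveryRayNear_of_value_eq_zero hnd htame)
  refine ⟨r₀, hr₀, fun r _ hr θ z₀ ⟨hz₀V, hz₀r⟩ => ?_⟩
  exact MixedMilnor.mem_closure_milnorFiber θ hz₀r
    (hrays z₀ (Metric.ball_subset_ball hr hz₀r) hz₀V)

theorem mainTheorem5 {n : ℕ} (f : MixedMilnor.MixedPolynomial n) (hf : f ≠ 0)
    (hnd : MixedMilnor.StronglyNondegenerate f) (htame : MixedMilnor.LocallyTame f) :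
    ∃ r₀ : ℝ, 0 < r₀ ∧ ∀ r : ℝ, 0 < r → r ≤ r₀ → MixedMilnor.StableBoundary f r :=
  mainTheorem5_general f hnd.1 htame
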